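/- For $f\in L^2(\mathbb{R}^2)$ and $k,l\in\mathbb{Z}$ define the twisted translation $T^t_{(k,l)}f(x,y)=e^{\pi i(xl-yk)}f(x-k,y-l)$, and for $a>0$ the dilation $D_af(x,y)=a\,f(ax,ay)$. Let $f\mapsto K_f$ be the unique linear isometry of $L^2(\mathbb{R}^2)$ into itself such that, for $f\in L^1\cap L^2(\mathbb{R}^2)$, $$K_f(\xi,\eta)=\int_{\mathbb{R}}f(x,\eta-\xi)\,e^{\pi i x(\eta+\xi)}\,dx\quad\text{for a.e. }(\xi,\eta)$$ (the kernel of the Weyl transform of $f$). A closed subspace $V\subset L^2(\mathbb{R}^2)$ is twisted shift-invariant if $T^t_{(k,l)}f\in V$ for all $f\in V$ and $k,l\in\mathbb{Z}$. For $\phi\in L^2(\mathbb{R}^2)$ let $V^t(\phi)=\overline{\operatorname{span}}\{T^t_{(k,l)}\phi:k,l\in\mathbb{Z}\}$; $\phi$ is a Parseval frame generator of $V^t(\phi)$ if $\|f\|^2=\sum_{k,l\in\mathbb{Z}}|\langle f,T^t_{(k,l)}\phi\rangle|^2$ for all $f\in V^t(\phi)$ (the function $\phi=0$ is allowed). Let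 $V$ be a twisted shift-invariant subspace of $L^2(\mathbb{R}^2)$, and let $V=\bigoplus_{n\in\mathbb{N}}V^t(\psi_n)$ be any decomposition of $V$ as an orthogonal direct sum (the closure of the sum of mutually orthogonal subspaces) in which each $\psi_n$ is a Parseval frame generator of $V^t(\psi_n)$. Let $$\sigma_V(\eta)=\sum_{n\in\mathbb{N}}\int_{\mathbb{R}}|K_{\psi_n}(\xi,\eta)|^2\,d\xi\in[0,\infty],\qquad \eta\in\mathbb{R},$$ be the corresponding spectral function. If $\sigma_V$ is integrable, that is, $\int_{\mathbb{R}}\sigma_V(\eta)\,d\eta<\infty$, then $$\bigcap_{j\in\mathbb{Z}}D_{2^j}(V)=\{0\},\qquad\text{where } D_{2^j}(V)=\{D_{2^j}f:f\in V\}.$$ -/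

import Mathlib

open MeasureTheory Filter Topology
open scoped ENNReal InnerProductSpace FourierTransform SchwartzMap

namespace TwistedShift

/-- The Hilbert space `L²(ℝ²)` of complex-valued functions. -/
abbrev L2Plane : Type := Lp ℂ 2 (volume : Measure (ℝ × ℝ))

/-- The integral
`K_f(ξ, η) = ∫ f(x, η - ξ) e^{π i x (η + ξ)} dx`
giving the kernel of the Weyl transform of `f` when `f ∈ L¹ ∩ L²`. -/
noncomputable def weylKernelIntegral (f : ℝ × ℝ → ℂ) (p : ℝ × ℝ) : ℂ :=
  ∫ x : ℝ, f (x, p.2 - p.1) * Complex.exp (Real.pi * Complex.I * x * (p.2 + p.1))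

theorem lintegral_fourier_sq (g : ℝ → ℂ) (h1 : Integrable g) (h2 : MemLp g 2) :
    ∫⁻ s, ‖𝓕 g s‖ₑ ^ 2 = ∫⁻ x, ‖g x‖ₑ ^ 2 := by
  have key : ((𝓕 (h2.toLp g) : Lp ℂ 2 (volume : Measure ℝ)) : ℝ → ℂ) =ᵐ[volume] 𝓕 g := by
    have hc : Continuous (𝓕 g) :=
      VectorFourier.fourierIntegral_continuous Real.continuous_fourierChar
        (by exact continuous_inner) h1
    apply ae_eq_of_integral_contDiff_smul_eq
    · exact (Lp.memLp _).locallyIntegrable (by norm_num)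
    · exact hc.locallyIntegrable
    · intro φ φ_smooth φ_cpt
      have hg₁ : HasCompactSupport (Complex.ofRealCLM ∘ φ) := φ_cpt.comp_left rfl
      have hg₂ : ContDiff ℝ (⊤ : ℕ∞) (Complex.ofRealCLM ∘ φ) := by fun_prop
      set Φ : 𝓢(ℝ, ℂ) := hg₁.toSchwartzMap hg₂ with hΦ
      have hΦx : ∀ x, Φ x = (φ x : ℂ) := fun x => by simp [hΦ]
      have e1 := congrArg (fun T => T Φ)
        (Lp.fourier_toTemperedDistribution_eq (h2.toLp g))
      simp only [TemperedDistribution.fourier_apply, Lp.toTemperedDistribution_apply] at e1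
      have e2 : ∫ x, (𝓕 Φ) x • (h2.toLp g) x = ∫ x, (𝓕 Φ) x • g x := by
        apply integral_congr_ae
        filter_upwards [h2.coeFn_toLp] with x hx
        rw [hx]
      have e3 : ∫ x, (𝓕 Φ) x • g x = ∫ x, Φ x • 𝓕 g x := by
        have := VectorFourier.integral_fourierIntegral_smul_eq_flip (L := innerₗ ℝ)
          (μ := (volume : Measure ℝ)) (ν := (volume : Measure ℝ)) (f := Φ) (g := g)
          Real.continuous_fourierChar continuous_inner Φ.integrable h1
        simpa [SchwartzMap.fourier_coe] using! this
      have e4 : ∀ h : ℝ → ℂ, ∫ x, φ x • h x = ∫ x, Φ x • h x := by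
        intro h
        simp [hΦx]
      rw [e4, e4, ← e3, ← e2, e1]
  have n1 : ‖𝓕 (h2.toLp g)‖ₑ = ‖h2.toLp g‖ₑ := by
    rw [enorm_eq_iff_norm_eq]
    exact Lp.norm_fourier_eq _
  rw [Lp.enorm_def, Lp.enorm_def, eLpNorm_congr_ae key, eLpNorm_congr_ae h2.coeFn_toLp] at n1
  have n2 := congrArg (fun t : ℝ≥0∞ => t ^ (2 : ℝ)) n1
  simp only [eLpNorm_eq_lintegral_rpow_enorm_toReal (two_ne_zero) (ENNReal.ofNat_ne_top)] at n2
  rw [← ENNReal.rpow_mul, ← ENNReal.rpow_mul] at n2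
  simpa using n2

theorem weylKernelIntegral_eq_fourier (f : ℝ × ℝ → ℂ) (p : ℝ × ℝ) :
    weylKernelIntegral f p = 𝓕 (fun x => f (x, p.2 - p.1)) (-((p.2 + p.1) / 2)) := by
  rw [Real.fourier_real_eq_integral_exp_smul, weylKernelIntegral]
  congr 1
  ext x
  rw [smul_eq_mul, mul_comm]
  congr 2
  push_cast
  ring

theorem stronglyMeasurable_weylKernelIntegral {f : ℝ × ℝ → ℂ} (hf : StronglyMeasurable f) :
    StronglyMeasurable (weylKernelIntegral f) := by
  unfold weylKernelIntegral
  refine StronglyMeasurable.integral_prod_right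
    (f := fun (p : ℝ × ℝ) (x : ℝ) => f (x, p.2 - p.1) * Complex.exp (Real.pi * Complex.I * x * (p.2 + p.1))) ?_
  refine StronglyMeasurable.mul ?_ ?_
  · exact hf.comp_measurable (by fun_prop)
  · exact Continuous.stronglyMeasurable (by fun_prop)

theorem ae_slice {P : ℝ × ℝ → Prop} (h : ∀ᵐ z, P z) :
    ∀ᵐ p : ℝ × ℝ, ∀ᵐ x : ℝ, P (x, p.2 - p.1) := by
  have h1 : ∀ᵐ z : ℝ × ℝ ∂((volume : Measure ℝ).prod volume), P z.swap :=
    (Measure.measurePreserving_swap (μ := (volume : Measure ℝ)) (ν := volume)).quasiMeasurePreserving.ae h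
  have h2 := Measure.ae_ae_of_ae_prod h1
  have h3 := (Measure.quasiMeasurePreserving_snd (μ := (volume : Measure ℝ))
    (ν := (volume : Measure ℝ))).ae h2
  exact (measurePreserving_prod_sub (volume : Measure ℝ) (volume : Measure ℝ)).quasiMeasurePreserving.ae h3

theorem ae_slice_integrable {f : ℝ × ℝ → ℂ} (h : Integrable f) :
    ∀ᵐ p : ℝ × ℝ, Integrable (fun x : ℝ => f (x, p.2 - p.1)) :=
  (measurePreserving_prod_sub (volume : Measure ℝ) (volume : Measure ℝ)).quasiMeasurePreserving.ae
    ((Measure.quasiMeasurePreserving_snd (μ := (volume : Measure ℝ))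
      (ν := (volume : Measure ℝ))).ae (Integrable.prod_left_ae h))

theorem integrable_mul_phase {g : ℝ → ℂ} (hg : Integrable g) (p : ℝ × ℝ) :
    Integrable (fun x : ℝ => g x * Complex.exp (Real.pi * Complex.I * x * (p.2 + p.1))) := by
  refine hg.mul_bdd (c := 1) (Continuous.aestronglyMeasurable (by fun_prop)) ?_
  refine Eventually.of_forall fun x => ?_
  have : (Real.pi * Complex.I * x * (p.2 + p.1) : ℂ)
      = ((Real.pi * x * (p.2 + p.1) : ℝ) : ℂ) * Complex.I := by
    push_cast
    ring
  rw [this, Complex.norm_exp_ofReal_mul_I]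

theorem lintegral_weylKernelIntegral {f : ℝ × ℝ → ℂ} (hm : StronglyMeasurable f)
    (h1 : Integrable f) (h2 : MemLp f 2) :
    ∫⁻ p, ‖weylKernelIntegral f p‖ₑ ^ 2 = ∫⁻ z, ‖f z‖ₑ ^ 2 := by
  have hK := stronglyMeasurable_weylKernelIntegral hm
  set H : ℝ × ℝ → ℝ≥0∞ :=
    fun q => ‖𝓕 (fun x : ℝ => f (x, q.2)) (-(q.1 + q.2 / 2))‖ₑ ^ 2 with hH
  have hHK : ∀ p : ℝ × ℝ, ‖weylKernelIntegral f p‖ₑ ^ 2 = H (p.1, p.2 - p.1) := by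
    intro p
    rw [weylKernelIntegral_eq_fourier, hH]
    ring_nf
  have hHm : Measurable H := by
    have : H = fun q => ‖weylKernelIntegral f (q.1, q.2 + q.1)‖ₑ ^ 2 := by
      ext q
      rw [hHK]
      simp
    rw [this]
    exact ((hK.comp_measurable (by fun_prop)).measurable.enorm).pow_const 2
  have hsq : Integrable (fun z => ‖f z‖ ^ 2) :=
    (memLp_two_iff_integrable_sq_norm hm.aestronglyMeasurable).1 h2
  have hs1 : ∀ᵐ v : ℝ, Integrable (fun x : ℝ => f (x, v)) :=
    Integrable.prod_left_ae (μ := (volume : Measure ℝ)) (ν := (volume : Measure ℝ)) h1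
  have hs2 : ∀ᵐ v : ℝ, Integrable (fun x : ℝ => ‖f (x, v)‖ ^ 2) :=
    Integrable.prod_left_ae (μ := (volume : Measure ℝ)) (ν := (volume : Measure ℝ)) hsq
  have hf2 : ∫⁻ z, ‖f z‖ₑ ^ 2 = ∫⁻ v : ℝ, ∫⁻ x : ℝ, ‖f (x, v)‖ₑ ^ 2 :=
    lintegral_prod_symm (μ := (volume : Measure ℝ)) (ν := (volume : Measure ℝ))
      (fun z => ‖f z‖ₑ ^ 2) (hm.measurable.enorm.pow_const 2).aemeasurable
  have hHs : ∫⁻ q, H q = ∫⁻ v : ℝ, ∫⁻ u : ℝ, H (u, v) :=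
    lintegral_prod_symm (μ := (volume : Measure ℝ)) (ν := (volume : Measure ℝ))
      H hHm.aemeasurable
  have hmp : ∫⁻ p : ℝ × ℝ, H (p.1, p.2 - p.1) = ∫⁻ q, H q :=
    (measurePreserving_prod_sub (volume : Measure ℝ) (volume : Measure ℝ)).lintegral_comp hHm
  rw [hf2]
  calc ∫⁻ p, ‖weylKernelIntegral f p‖ₑ ^ 2
      = ∫⁻ p : ℝ × ℝ, H (p.1, p.2 - p.1) := by simp_rw [hHK]
    _ = ∫⁻ v : ℝ, ∫⁻ u : ℝ, H (u, v) := by rw [hmp, hHs]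
    _ = ∫⁻ v : ℝ, ∫⁻ x : ℝ, ‖f (x, v)‖ₑ ^ 2 := by
        apply lintegral_congr_ae
        filter_upwards [hs1, hs2] with v hv1 hv2
        have hv3 : MemLp (fun x => f (x, v)) 2 :=
          (memLp_two_iff_integrable_sq_norm hv1.aestronglyMeasurable).2 hv2
        rw [← lintegral_fourier_sq _ hv1 hv3]
        simp only [hH]
        rw [lintegral_add_right_eq_self
          (fun u : ℝ => ‖𝓕 (fun x : ℝ => f (x, v)) (-u)‖ₑ ^ 2) (v / 2)]
        exact lintegral_neg_eq_self (fun u : ℝ => ‖𝓕 (fun x : ℝ => f (x, v)) u‖ₑ ^ 2)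

theorem eLpNorm_two_sq {f g : ℝ × ℝ → ℂ} (h : ∫⁻ p, ‖f p‖ₑ ^ 2 = ∫⁻ p, ‖g p‖ₑ ^ 2) :
    eLpNorm f 2 volume = eLpNorm g 2 volume := by
  simp only [eLpNorm_eq_lintegral_rpow_enorm_toReal (two_ne_zero) (ENNReal.ofNat_ne_top)]
  simp [h]

/-- Square integrable functions on the plane that are also integrable. -/
def integrableSubmodule : Submodule ℂ L2Plane where
  carrier := {f | Integrable f (volume : Measure (ℝ × ℝ))}
  add_mem' {f g} hf hg := (Integrable.add hf hg).congr (Lp.coeFn_add f g).symm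
  zero_mem' := (integrable_zero (ℝ × ℝ) ℂ volume).congr (Lp.coeFn_zero ℂ 2 volume).symm
  smul_mem' c f hf := (Integrable.smul c hf).congr (Lp.coeFn_smul c f).symm

theorem dense_integrableSubmodule : DenseRange integrableSubmodule.subtype := by
  have h := SchwartzMap.denseRange_toLpCLM (E := ℝ × ℝ) (F := ℂ) (p := 2) (μ := volume)
    ENNReal.ofNat_ne_top
  refine Dense.mono ?_ h
  rintro _ ⟨φ, rfl⟩
  have hφ : Integrable (SchwartzMap.toLpCLM ℝ ℂ 2 (volume : Measure (ℝ × ℝ)) φ) :=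
    φ.integrable.congr (φ.coeFn_toLp 2 volume).symm
  exact ⟨⟨_, hφ⟩, rfl⟩

theorem memLp_weylKernelIntegral (f : integrableSubmodule) :
    MemLp (weylKernelIntegral (f : L2Plane)) 2 := by
  have hm := Lp.stronglyMeasurable (f : L2Plane)
  refine ⟨(stronglyMeasurable_weylKernelIntegral hm).aestronglyMeasurable, ?_⟩
  rw [eLpNorm_two_sq (lintegral_weylKernelIntegral hm f.2 (Lp.memLp _))]
  exact (Lp.memLp (f : L2Plane)).2

/-- For every square integrable `f` there is one square integrable kernel `K_f`, depending linearly
and isometrically on `f`, which is given by the integral formula when `f` is also integrable. -/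
theorem existsUnique_weylKernel :
    ∃! W : L2Plane →ₗᵢ[ℂ] L2Plane,
      ∀ f : L2Plane, Integrable f → W f =ᵐ[volume] weylKernelIntegral f := by
  let k : integrableSubmodule →ₗ[ℂ] L2Plane :=
    { toFun := fun f => (memLp_weylKernelIntegral f).toLp _
      map_add' := by
        intro f g
        apply Lp.ext
        filter_upwards [MemLp.coeFn_toLp (memLp_weylKernelIntegral (f + g)),
          Lp.coeFn_add ((memLp_weylKernelIntegral f).toLp _) ((memLp_weylKernelIntegral g).toLp _),
          MemLp.coeFn_toLp (memLp_weylKernelIntegral f),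
          MemLp.coeFn_toLp (memLp_weylKernelIntegral g),
          ae_slice (Lp.coeFn_add (f : L2Plane) (g : L2Plane)), ae_slice_integrable f.2,
          ae_slice_integrable g.2] with p h1 h2 h3 h4 h5 h6 h7
        rw [h1, h2, Pi.add_apply, h3, h4]
        simp only [weylKernelIntegral]
        rw [← integral_add (integrable_mul_phase h6 _) (integrable_mul_phase h7 _)]
        apply integral_congr_ae
        filter_upwards [h5] with x hx
        rw [Submodule.coe_add, hx, Pi.add_apply, add_mul]
      map_smul' := by
        intro c f
        apply Lp.ext
        filter_upwards [MemLp.coeFn_toLp (memLp_weylKernelIntegral (c • f)),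
          Lp.coeFn_smul c ((memLp_weylKernelIntegral f).toLp _),
          MemLp.coeFn_toLp (memLp_weylKernelIntegral f),
          ae_slice (Lp.coeFn_smul c (f : L2Plane))] with p h1 h2 h3 h5
        rw [h1, RingHom.id_apply, h2, Pi.smul_apply, h3]
        simp only [weylKernelIntegral]
        rw [smul_eq_mul, ← integral_const_mul]
        apply integral_congr_ae
        filter_upwards [h5] with x hx
        rw [Submodule.coe_smul, hx, Pi.smul_apply, smul_eq_mul, mul_assoc] }
  have hk : ∀ f, k f = (memLp_weylKernelIntegral f).toLp _ := fun f => rfl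
  have hnorm : ∀ f, ‖k f‖ = ‖integrableSubmodule.subtype f‖ := by
    intro f
    rw [hk, Lp.norm_toLp, Submodule.subtype_apply, Lp.norm_def]
    rw [eLpNorm_two_sq (lintegral_weylKernelIntegral (Lp.stronglyMeasurable (f : L2Plane)) f.2
      (Lp.memLp _))]
  have hb : ∃ C, ∀ f, ‖k f‖ ≤ C * ‖integrableSubmodule.subtype f‖ :=
    ⟨1, fun f => by rw [hnorm, one_mul]⟩
  have hext := LinearMap.extendOfNorm_eq (f := k) (e := integrableSubmodule.subtype)
    dense_integrableSubmodule hb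
  let T := k.extendOfNorm integrableSubmodule.subtype
  have hT : ∀ f, ‖T f‖ = ‖f‖ := by
    intro f
    refine dense_integrableSubmodule.induction_on (p := fun f => ‖T f‖ = ‖f‖) f
      (isClosed_eq (by fun_prop) (by fun_prop)) ?_
    intro g
    rw [hext g, hnorm]
  refine ⟨⟨T.toLinearMap, hT⟩, ?_, ?_⟩
  · intro f hf
    have h1 : T f = k ⟨f, hf⟩ := hext ⟨f, hf⟩
    change T f =ᵐ[volume] _
    rw [h1]
    exact MemLp.coeFn_toLp (memLp_weylKernelIntegral ⟨f, hf⟩)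
  · intro W hW
    ext1 f
    refine dense_integrableSubmodule.induction_on (p := fun f => W f = T f) f
      (isClosed_eq (by fun_prop) (by fun_prop)) ?_
    intro g
    rw [hext g]
    apply Lp.ext
    exact (hW g g.2).trans (MemLp.coeFn_toLp (memLp_weylKernelIntegral g)).symm

/-- The linear isometry `f ↦ K_f` of `L²(ℝ²)` sending `f` to the kernel of its Weyl transform: the
unique isometric extension of the integral formula from `L¹ ∩ L²`. -/
noncomputable def weylKernel : L2Plane →ₗᵢ[ℂ] L2Plane :=
  existsUnique_weylKernel.choose

theorem weylKernel_ae_eq (f : L2Plane) (hf : Integrable f) :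
    weylKernel f =ᵐ[volume] weylKernelIntegral f :=
  existsUnique_weylKernel.choose_spec.1 f hf

theorem memLp_twistedTranslation (k l : ℤ) (f : L2Plane) :
    MemLp (fun p : ℝ × ℝ =>
      Complex.exp (Real.pi * Complex.I * (p.1 * l - p.2 * k)) * f (p.1 - k, p.2 - l)) 2 := by
  have h1 : MemLp (fun p : ℝ × ℝ => f (p.1 - k, p.2 - l)) 2 :=
    (Lp.memLp f).comp_measurePreserving
      (measurePreserving_sub_right (volume : Measure (ℝ × ℝ)) ((k : ℝ), (l : ℝ)))
  refine h1.of_le ((Continuous.aestronglyMeasurable (by fun_prop)).mul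
    h1.aestronglyMeasurable) (Eventually.of_forall fun p => ?_)
  have : (Real.pi * Complex.I * (p.1 * l - p.2 * k) : ℂ)
      = ((Real.pi * (p.1 * l - p.2 * k) : ℝ) : ℂ) * Complex.I := by
    push_cast
    ring
  rw [norm_mul, this, Complex.norm_exp_ofReal_mul_I, one_mul]

/-- The twisted translation
`(T_{(k,l)} f)(x, y) = e^{π i (x l - y k)} f(x - k, y - l)`. -/
noncomputable def twistedTranslation (k l : ℤ) (f : L2Plane) : L2Plane :=
  (memLp_twistedTranslation k l f).toLp _

theorem memLp_dilation (a : ℝ) (ha : 0 < a) (f : L2Plane) :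
    MemLp (fun p : ℝ × ℝ => (a : ℂ) * f (a * p.1, a * p.2)) 2 := by
  have hne : a ≠ 0 := ha.ne'
  have hmap : Measure.map (fun p : ℝ × ℝ => a • p) volume
      = ENNReal.ofReal |(a ^ (Module.finrank ℝ (ℝ × ℝ)))⁻¹| • (volume : Measure (ℝ × ℝ)) :=
    Measure.map_addHaar_smul volume hne
  have h1 : MemLp f 2 (Measure.map (fun p : ℝ × ℝ => a • p) volume) := by
    rw [hmap]
    exact (Lp.memLp f).smul_measure ENNReal.ofReal_ne_top
  exact (h1.comp_of_map (by fun_prop)).const_mul (a : ℂ)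

/-- The dilation `(D_a f)(x, y) = a f(a x, a y)`, for `a > 0`. -/
noncomputable def dilation (a : ℝ) (ha : 0 < a) (f : L2Plane) : L2Plane :=
  (memLp_dilation a ha f).toLp _

/-- A closed subspace of `L²(ℝ²)` is twisted shift-invariant if it is stable under all twisted
translations. -/
structure IsTwistedShiftInvariant (V : Submodule ℂ L2Plane) : Prop where
  isClosed : IsClosed (V : Set L2Plane)
  translation_mem : ∀ f ∈ V, ∀ k l : ℤ, twistedTranslation k l f ∈ V

/-- The principal twisted shift-invariant space `V^t(φ)`, the closed linear span of the twisted
translates of `φ`. -/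
noncomputable def principalSpace (φ : L2Plane) : Submodule ℂ L2Plane :=
  (Submodule.span ℂ (Set.range fun p : ℤ × ℤ => twistedTranslation p.1 p.2 φ)).topologicalClosure

/-- The twisted translates of `φ` form a Parseval frame for `V^t(φ)`. The function `φ = 0` is
allowed. -/
def IsParsevalFrameGenerator (φ : L2Plane) : Prop :=
  ∀ f ∈ principalSpace φ,
    HasSum (fun p : ℤ × ℤ => ‖⟪f, twistedTranslation p.1 p.2 φ⟫_ℂ‖ ^ 2) (‖f‖ ^ 2)

/-- `V` is the orthogonal direct sum of the principal spaces `V^t(ψ n)`, each `ψ n` being a Parseval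
frame generator. -/
structure IsParsevalDecomposition (V : Submodule ℂ L2Plane) (ψ : ℕ → L2Plane) : Prop where
  isParsevalFrameGenerator : ∀ n, IsParsevalFrameGenerator (ψ n)
  orthogonal : Pairwise fun m n => principalSpace (ψ m) ⟂ principalSpace (ψ n)
  eq_closure_iSup : V = (⨆ n, principalSpace (ψ n)).topologicalClosure

/-- The spectral function `∫ |K_ψ(ξ, η)|² dξ` of the principal space with Parseval frame
generator `ψ`, with values in `[0, ∞]`. -/
noncomputable def principalSpectralFunction (ψ : L2Plane) (η : ℝ) : ℝ≥0∞ :=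
  ∫⁻ ξ : ℝ, ‖weylKernel ψ (ξ, η)‖ₑ ^ 2

/-- The spectral function `∑ₙ ∫ |K_{ψ n}(ξ, η)|² dξ` obtained from a decomposition with Parseval
frame generators `ψ n`. -/
noncomputable def spectralFunction (ψ : ℕ → L2Plane) (η : ℝ) : ℝ≥0∞ :=
  ∑' n, principalSpectralFunction (ψ n) η

end TwistedShift

namespace TwistedShift

/-! Since `weylKernel` is an isometry, integrability of the spectral function says exactly that `∑
‖ψ n‖²` is finite (`lintegral_spectralFunction`). Hence the sum of `|ψ n|²` over all `n` and all
integer translates is integrable on a unit square, and its integral over a shrinking ball tends to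
`0` (`tendsto_setLIntegral_ball_periodization`).

Let `P` be the orthogonal projection onto `V`. The Parseval identity expands `‖P u‖²` in the
coefficients `⟪u, T ψ n⟫`. If `u` lives on `S`, Cauchy–Schwarz on `S` bounds `‖P u‖²` by `‖u‖²`
times the integral of that sum over `S` (`IsParsevalDecomposition.enorm_starProjection_sq_le`). The
twist is a unimodular factor and disappears in this bound.

If `f` is in every dilate of `V`, then `g = D_{1/a} f` is in `V` for `a = 2^(-m)`. Approximate `f`
within `‖f‖ / 2` by a compactly supported `h`. Then `u = D_{1/a} h` is concentrated near the origin,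
so `P u` tends to `0`; yet `‖P u‖ ≥ ‖g‖ - ‖g - u‖ ≥ ‖f‖ / 2`. Thus `f = 0`. -/

theorem L2Plane.enorm_sq (f : L2Plane) : ‖f‖ₑ ^ 2 = ∫⁻ z, ‖f z‖ₑ ^ 2 := by
  rw [Lp.enorm_def, eLpNorm_eq_lintegral_rpow_enorm_toReal two_ne_zero ENNReal.ofNat_ne_top,
    ← ENNReal.rpow_natCast, ← ENNReal.rpow_mul]
  simp

/-! ### Dilations of the plane. -/

theorem quasiMeasurePreserving_smul_plane {a : ℝ} (ha : a ≠ 0) :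
    Measure.QuasiMeasurePreserving (fun z : ℝ × ℝ => (a * z.1, a * z.2)) := by
  refine ⟨by fun_prop, ?_⟩
  have h : Measure.map (fun p : ℝ × ℝ => a • p) volume
      = ENNReal.ofReal |(a ^ (Module.finrank ℝ (ℝ × ℝ)))⁻¹| • (volume : Measure (ℝ × ℝ)) :=
    Measure.map_addHaar_smul volume ha
  change Measure.map (fun p : ℝ × ℝ => a • p) volume ≪ _
  rw [h]
  exact Measure.smul_absolutelyContinuous

theorem coeFn_dilation (a : ℝ) (ha : 0 < a) (f : L2Plane) :
    dilation a ha f =ᵐ[volume] fun z => (a : ℂ) * f (a * z.1, a * z.2) :=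
  MemLp.coeFn_toLp _

theorem enorm_dilation (a : ℝ) (ha : 0 < a) (f : L2Plane) : ‖dilation a ha f‖ₑ = ‖f‖ₑ := by
  have h : Measure.map (fun p : ℝ × ℝ => a • p) volume
      = ENNReal.ofReal |(a ^ (Module.finrank ℝ (ℝ × ℝ)))⁻¹| • (volume : Measure (ℝ × ℝ)) :=
    Measure.map_addHaar_smul volume ha.ne'
  have hm : Measurable fun z => ‖f z‖ₑ ^ 2 :=
    (Lp.stronglyMeasurable f).measurable.enorm.pow_const 2
  have h2 := lintegral_map (μ := volume) hm (g := fun p : ℝ × ℝ => a • p) (by fun_prop)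
  rw [h, lintegral_smul_measure] at h2
  refine (ENNReal.pow_right_strictMono two_ne_zero).injective ?_
  rw [L2Plane.enorm_sq, L2Plane.enorm_sq]
  calc ∫⁻ z, ‖dilation a ha f z‖ₑ ^ 2
      = ∫⁻ z : ℝ × ℝ, ENNReal.ofReal (a ^ 2) * ‖f (a • z)‖ₑ ^ 2 := by
        apply lintegral_congr_ae
        filter_upwards [coeFn_dilation a ha f] with z hz
        have ea : ‖(a : ℂ)‖ₑ = ENNReal.ofReal a := by
          rw [← ofReal_norm]
          simp [abs_of_pos ha]
        rw [hz, enorm_mul, mul_pow, ENNReal.ofReal_pow ha.le, ea]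
        rfl
    _ = ∫⁻ z, ‖f z‖ₑ ^ 2 := by
        rw [lintegral_const_mul' _ _ ENNReal.ofReal_ne_top, ← h2, smul_eq_mul, ← mul_assoc,
          ← ENNReal.ofReal_mul (by positivity)]
        have e : a ^ 2 * |(a ^ (Module.finrank ℝ (ℝ × ℝ)))⁻¹| = 1 := by
          have : Module.finrank ℝ (ℝ × ℝ) = 2 := by simp
          rw [this, abs_of_pos (by positivity)]
          field_simp
        rw [e]
        simp

theorem dilation_sub (a : ℝ) (ha : 0 < a) (f g : L2Plane) :
    dilation a ha (f - g) = dilation a ha f - dilation a ha g := by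
  apply Lp.ext
  filter_upwards [coeFn_dilation a ha (f - g), coeFn_dilation a ha f, coeFn_dilation a ha g,
    Lp.coeFn_sub (dilation a ha f) (dilation a ha g),
    (quasiMeasurePreserving_smul_plane ha.ne').ae (Lp.coeFn_sub f g)] with z h1 h2 h3 h4 h5
  rw [h1, h4, Pi.sub_apply, h2, h3, h5, Pi.sub_apply, mul_sub]

theorem dilation_zero (a : ℝ) (ha : 0 < a) : dilation a ha 0 = 0 := by
  simpa using dilation_sub a ha 0 0

theorem dilation_inv_dilation (a : ℝ) (ha : 0 < a) (f : L2Plane) :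
    dilation a⁻¹ (inv_pos.2 ha) (dilation a ha f) = f := by
  apply Lp.ext
  filter_upwards [coeFn_dilation a⁻¹ (inv_pos.2 ha) (dilation a ha f),
    (quasiMeasurePreserving_smul_plane (inv_pos.2 ha).ne').ae (coeFn_dilation a ha f)]
    with z h1 h2
  have hc : (a : ℂ) ≠ 0 := by exact_mod_cast ha.ne'
  rw [h1, h2, ← mul_assoc]
  simp [ha.ne', hc]

theorem dilation_ae_eq_zero_of_ae_eq_zero {a r : ℝ} (ha : 0 < a) {f : L2Plane}
    (hf : ∀ᵐ z : ℝ × ℝ, z ∉ Metric.ball (0 : ℝ × ℝ) r → f z = 0) :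
    ∀ᵐ z : ℝ × ℝ, z ∉ Metric.ball (0 : ℝ × ℝ) (r / a) → dilation a ha f z = 0 := by
  filter_upwards [coeFn_dilation a ha f, (quasiMeasurePreserving_smul_plane ha.ne').ae hf]
    with z h1 h2 hz
  rw [h1, h2, mul_zero]
  contrapose! hz
  rw [mem_ball_zero_iff] at hz ⊢
  change ‖a • z‖ < r at hz
  rw [norm_smul, Real.norm_of_nonneg ha.le] at hz
  rwa [lt_div_iff₀' ha]

/-! ### Twisted translates and the Parseval identity. -/

theorem enorm_twistedTranslation_apply (k l : ℤ) (f : L2Plane) :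
    ∀ᵐ z : ℝ × ℝ, ‖twistedTranslation k l f z‖ₑ = ‖f (z - ((k : ℝ), (l : ℝ)))‖ₑ := by
  filter_upwards [MemLp.coeFn_toLp (memLp_twistedTranslation k l f)] with z hz
  have : (Real.pi * Complex.I * (z.1 * l - z.2 * k) : ℂ)
      = ((Real.pi * (z.1 * l - z.2 * k) : ℝ) : ℂ) * Complex.I := by
    push_cast
    ring
  have h1 : ‖Complex.exp (Real.pi * Complex.I * (z.1 * l - z.2 * k))‖ₑ = 1 := by
    rw [← ofReal_norm, this, Complex.norm_exp_ofReal_mul_I, ENNReal.ofReal_one]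
  rw [twistedTranslation, hz, enorm_mul, h1, one_mul]
  rfl

theorem enorm_inner_sq_le_of_ae_eq_zero {u : L2Plane} {S : Set (ℝ × ℝ)} (hS : MeasurableSet S)
    (hu : ∀ᵐ z : ℝ × ℝ, z ∉ S → u z = 0) (t : L2Plane) :
    ‖⟪u, t⟫_ℂ‖ₑ ^ 2 ≤ ‖u‖ₑ ^ 2 * ∫⁻ z in S, ‖t z‖ₑ ^ 2 := by
  have ht : MemLp (S.indicator t) 2 (volume : Measure (ℝ × ℝ)) := (Lp.memLp t).indicator hS
  -- Cutting `t` off outside `S` does not change its pairing with `u`, so Cauchy–Schwarz only costs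
  -- the mass of `t` on `S`.
  have h1 : ⟪u, t⟫_ℂ = ⟪u, ht.toLp _⟫_ℂ := by
    rw [L2.inner_def, L2.inner_def]
    apply integral_congr_ae
    filter_upwards [hu, ht.coeFn_toLp] with z h2 h3
    rw [h3]
    by_cases hz : z ∈ S
    · rw [Set.indicator_of_mem hz]
    · rw [h2 hz, inner_zero_left, inner_zero_left]
  have h2 : ‖ht.toLp _‖ₑ ^ 2 = ∫⁻ z in S, ‖t z‖ₑ ^ 2 := by
    rw [L2Plane.enorm_sq, ← lintegral_indicator hS]
    apply lintegral_congr_ae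
    filter_upwards [ht.coeFn_toLp] with z h3
    rw [h3]
    by_cases hz : z ∈ S <;> simp [hz]
  rw [← h2, h1, ← mul_pow]
  gcongr
  rw [← ofReal_norm, ← ofReal_norm, ← ofReal_norm,
    ← ENNReal.ofReal_mul (norm_nonneg _)]
  exact ENNReal.ofReal_le_ofReal (norm_inner_le_norm _ _)

theorem twistedTranslation_mem_principalSpace (φ : L2Plane) (k l : ℤ) :
    twistedTranslation k l φ ∈ principalSpace φ :=
  Submodule.le_topologicalClosure _ (Submodule.subset_span ⟨(k, l), rfl⟩)

theorem IsParsevalFrameGenerator.enorm_sq {φ : L2Plane} (h : IsParsevalFrameGenerator φ)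
    {f : L2Plane} (hf : f ∈ principalSpace φ) :
    ‖f‖ₑ ^ 2 = ∑' p : ℤ × ℤ, ‖⟪f, twistedTranslation p.1 p.2 φ⟫_ℂ‖ₑ ^ 2 := by
  have h1 := h f hf
  have h2 := ENNReal.ofReal_tsum_of_nonneg (fun p => by positivity) h1.summable
  rw [h1.tsum_eq] at h2
  simpa only [ENNReal.ofReal_pow (norm_nonneg _), ofReal_norm] using h2

/-- Write `f` as an orthogonal sum of components `x n` in the principal spaces. A translate of `ψ n`
pairs only with `x n`, so Pythagoras reduces the claim to the Parseval identity in each summand. -/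
theorem IsParsevalDecomposition.enorm_sq {V : Submodule ℂ L2Plane} {ψ : ℕ → L2Plane}
    (h : IsParsevalDecomposition V ψ) {f : L2Plane} (hf : f ∈ V) :
    ‖f‖ₑ ^ 2 = ∑' n, ∑' p : ℤ × ℤ, ‖⟪f, twistedTranslation p.1 p.2 (ψ n)⟫_ℂ‖ₑ ^ 2 := by
  have hO : OrthogonalFamily ℂ (fun n => principalSpace (ψ n))
      fun n => (principalSpace (ψ n)).subtypeₗᵢ :=
    OrthogonalFamily.of_pairwise h.orthogonal
  have : ∀ n, CompleteSpace (principalSpace (ψ n)) := fun n =>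
    (Submodule.isClosed_topologicalClosure _).completeSpace_coe
  have hr := hO.range_linearIsometry
  have hf' : f ∈ LinearMap.range hO.linearIsometry.toLinearMap := by
    rw [hr]
    simpa [← h.eq_closure_iSup] using hf
  obtain ⟨x, rfl⟩ := hf'
  have hs := hO.hasSum_linearIsometry x
  have hin : ∀ n (t : L2Plane), t ∈ principalSpace (ψ n) →
      ⟪hO.linearIsometry x, t⟫_ℂ = ⟪(x n : L2Plane), t⟫_ℂ := by
    intro n t ht
    have h1 : HasSum (fun i => ⟪t, (x i : L2Plane)⟫_ℂ) ⟪t, hO.linearIsometry x⟫_ℂ :=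
      hs.mapL (innerSL ℂ t)
    have h2 : HasSum (fun i => ⟪t, (x i : L2Plane)⟫_ℂ) ⟪t, (x n : L2Plane)⟫_ℂ :=
      hasSum_single n fun i hi => (h.orthogonal hi.symm).inner_eq ht (x i).2
    rw [← inner_conj_symm, h1.unique h2, inner_conj_symm]
  have hn : ‖x‖ₑ ^ 2 = ∑' n, ‖(x n : L2Plane)‖ₑ ^ 2 := by
    have h1 := lp.hasSum_norm (p := 2) (by norm_num) x
    have h2 := ENNReal.ofReal_tsum_of_nonneg (fun n => by positivity) h1.summable
    rw [h1.tsum_eq] at h2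
    simpa only [ENNReal.toReal_ofNat, Real.rpow_ofNat, ENNReal.ofReal_pow (norm_nonneg _),
      ofReal_norm] using! h2
  change ‖hO.linearIsometry x‖ₑ ^ 2 = ∑' n, ∑' p : ℤ × ℤ,
    ‖⟪hO.linearIsometry x, twistedTranslation p.1 p.2 (ψ n)⟫_ℂ‖ₑ ^ 2
  rw [LinearIsometry.enorm_map, hn]
  refine tsum_congr fun n => ?_
  rw [(h.isParsevalFrameGenerator n).enorm_sq (x n).2]
  refine tsum_congr fun p => ?_
  rw [hin n _ (twistedTranslation_mem_principalSpace _ _ _)]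

/-! ### Local integrability of the periodization. -/

/-- The sum of the squared moduli of all integer translates of a family of functions. -/
noncomputable def periodization (ψ : ℕ → L2Plane) (z : ℝ × ℝ) : ℝ≥0∞ :=
  ∑' n, ∑' p : ℤ × ℤ, ‖ψ n (z - ((p.1 : ℝ), (p.2 : ℝ)))‖ₑ ^ 2

theorem lintegral_periodization (ψ : ℕ → L2Plane) (S : Set (ℝ × ℝ)) :
    ∫⁻ z in S, periodization ψ z
      = ∑' n, ∑' p : ℤ × ℤ, ∫⁻ z in S, ‖ψ n (z - ((p.1 : ℝ), (p.2 : ℝ)))‖ₑ ^ 2 := by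
  have hm : ∀ n (p : ℤ × ℤ), Measurable
      fun z : ℝ × ℝ => ‖ψ n (z - ((p.1 : ℝ), (p.2 : ℝ)))‖ₑ ^ 2 := fun n p =>
    ((Lp.stronglyMeasurable (ψ n)).measurable.comp (by fun_prop)).enorm.pow_const 2
  unfold periodization
  rw [lintegral_tsum fun n => (Measurable.tsum (hm n)).aemeasurable]
  exact tsum_congr fun n => lintegral_tsum fun p => (hm n p).aemeasurable

/-- In the sup norm of `ℝ × ℝ` the ball of radius `1 / 2` is an open unit square, whose integer
translates are pairwise disjoint. -/
theorem tsum_setLIntegral_translate_le (f : L2Plane) :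
    ∑' p : ℤ × ℤ, ∫⁻ z in Metric.ball (0 : ℝ × ℝ) (1 / 2),
      ‖f (z - ((p.1 : ℝ), (p.2 : ℝ)))‖ₑ ^ 2 ≤ ‖f‖ₑ ^ 2 := by
  set B : ℤ × ℤ → Set (ℝ × ℝ) := fun p =>
    (fun z : ℝ × ℝ => z + ((p.1 : ℝ), (p.2 : ℝ))) ⁻¹' Metric.ball (0 : ℝ × ℝ) (1 / 2) with hB
  have hBm : ∀ p, MeasurableSet (B p) := fun p =>
    measurableSet_preimage (by fun_prop) Metric.isOpen_ball.measurableSet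
  have hd : Pairwise (Function.onFun Disjoint B) := by
    intro p q hpq
    refine Set.disjoint_left.2 fun z hp hq => hpq ?_
    have key : ∀ (x : ℝ) (a b : ℤ), |x + a| < 1 / 2 → |x + b| < 1 / 2 → a = b := by
      intro x a b h1 h2
      rw [abs_lt] at h1 h2
      have h3 : ((a - b : ℤ) : ℝ) < (1 : ℤ) := by push_cast; linarith
      have h4 : ((-1 : ℤ) : ℝ) < (a - b : ℤ) := by push_cast; linarith
      have h5 := Int.cast_lt.1 h3
      have h6 := Int.cast_lt.1 h4
      omega
    simp only [hB, Set.mem_preimage, mem_ball_zero_iff, Prod.norm_def, max_lt_iff, Prod.fst_add,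
      Prod.snd_add, Real.norm_eq_abs] at hp hq
    exact Prod.ext (key _ _ _ hp.1 hq.1) (key _ _ _ hp.2 hq.2)
  calc _ = ∑' p, ∫⁻ z in B p, ‖f z‖ₑ ^ 2 := by
        refine tsum_congr fun p => ?_
        rw [← lintegral_indicator (hBm p), ← lintegral_indicator Metric.isOpen_ball.measurableSet,
          ← lintegral_sub_right_eq_self ((B p).indicator _) ((p.1 : ℝ), (p.2 : ℝ))]
        refine lintegral_congr fun z => ?_
        have hz : z - ((p.1 : ℝ), (p.2 : ℝ)) ∈ B p ↔ z ∈ Metric.ball (0 : ℝ × ℝ) (1 / 2) := by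
          simp only [B, Set.mem_preimage, sub_add_cancel]
        by_cases h : z ∈ Metric.ball (0 : ℝ × ℝ) (1 / 2)
        · rw [Set.indicator_of_mem h, Set.indicator_of_mem (hz.2 h)]
        · rw [Set.indicator_of_notMem h, Set.indicator_of_notMem (mt hz.1 h)]
    _ = ∫⁻ z in ⋃ p, B p, ‖f z‖ₑ ^ 2 := (lintegral_iUnion hBm hd _).symm
    _ ≤ ∫⁻ z, ‖f z‖ₑ ^ 2 := setLIntegral_le_lintegral _ _
    _ = ‖f‖ₑ ^ 2 := (L2Plane.enorm_sq f).symm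

/-- Tonelli turns each term into `‖weylKernel (ψ n)‖²`, and the Weyl kernel map is isometric. -/
theorem lintegral_spectralFunction (ψ : ℕ → L2Plane) :
    ∫⁻ η, spectralFunction ψ η = ∑' n, ‖ψ n‖ₑ ^ 2 := by
  have hm : ∀ n, Measurable fun z => ‖weylKernel (ψ n) z‖ₑ ^ 2 := fun n =>
    (Lp.stronglyMeasurable (weylKernel (ψ n))).measurable.enorm.pow_const 2
  unfold spectralFunction principalSpectralFunction
  rw [lintegral_tsum fun n => ((hm n).lintegral_prod_left' ).aemeasurable]
  refine tsum_congr fun n => ?_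
  rw [← weylKernel.enorm_map (ψ n), L2Plane.enorm_sq]
  exact (lintegral_prod_symm (μ := (volume : Measure ℝ)) (ν := (volume : Measure ℝ)) _
    (hm n).aemeasurable).symm

theorem setLIntegral_ball_periodization_lt_top {ψ : ℕ → L2Plane}
    (hσ : ∫⁻ η, spectralFunction ψ η < ∞) :
    ∫⁻ z in Metric.ball (0 : ℝ × ℝ) (1 / 2), periodization ψ z < ∞ := by
  refine lt_of_le_of_lt ?_ hσ
  rw [lintegral_periodization, lintegral_spectralFunction]
  exact ENNReal.tsum_le_tsum fun n => tsum_setLIntegral_translate_le (ψ n)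

/-- Absolute continuity of the integral, applied to the measure restricted to the ball of radius `1
/ 2`, where the periodization is known to be integrable; the smaller balls are eventually inside it.
-/
theorem tendsto_setLIntegral_ball_periodization {ψ : ℕ → L2Plane}
    (hσ : ∫⁻ η, spectralFunction ψ η < ∞) {r : ℕ → ℝ} (hr : Tendsto r atTop (𝓝 0)) :
    Tendsto (fun m => ∫⁻ z in Metric.ball (0 : ℝ × ℝ) (r m), periodization ψ z) atTop (𝓝 0) := by
  have hv : Tendsto (fun m => (volume.restrict (Metric.ball (0 : ℝ × ℝ) (1 / 2)))
      (Metric.ball (0 : ℝ × ℝ) (r m))) atTop (𝓝 0) := by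
    have h1 : Tendsto (fun m => ENNReal.ofReal (2 * r m) * ENNReal.ofReal (2 * r m))
        atTop (𝓝 0) := by
      have h2 : Tendsto (fun m => ENNReal.ofReal (2 * r m)) atTop (𝓝 0) := by
        have h3 := ENNReal.tendsto_ofReal (hr.const_mul 2)
        rwa [mul_zero, ENNReal.ofReal_zero] at h3
      have h4 := ENNReal.Tendsto.mul h2 (Or.inr ENNReal.zero_ne_top) h2
        (Or.inr ENNReal.zero_ne_top)
      rwa [mul_zero] at h4
    refine tendsto_of_tendsto_of_tendsto_of_le_of_le tendsto_const_nhds h1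
      (fun m => zero_le) fun m => ?_
    refine (Measure.restrict_apply_le _ _).trans (le_of_eq ?_)
    rw [← Prod.mk_zero_zero, ← ball_prod_same, Measure.volume_eq_prod, Measure.prod_prod,
      Real.volume_ball]
  have h := tendsto_setLIntegral_zero (setLIntegral_ball_periodization_lt_top hσ).ne hv
  refine h.congr' ?_
  filter_upwards [hr.eventually (gt_mem_nhds (by norm_num : (0 : ℝ) < 1 / 2))] with m hm
  rw [Measure.restrict_restrict Metric.isOpen_ball.measurableSet,
    Set.inter_eq_self_of_subset_left (Metric.ball_subset_ball hm.le)]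

/-! ### Projection of concentrated functions onto `V`. -/

theorem IsParsevalDecomposition.principalSpace_le {V : Submodule ℂ L2Plane} {ψ : ℕ → L2Plane}
    (h : IsParsevalDecomposition V ψ) (n : ℕ) : principalSpace (ψ n) ≤ V := by
  rw [h.eq_closure_iSup]
  exact (le_iSup (fun n => principalSpace (ψ n)) n).trans (Submodule.le_topologicalClosure _)

theorem IsParsevalDecomposition.enorm_starProjection_sq_le {V : Submodule ℂ L2Plane}
    [V.HasOrthogonalProjection] {ψ : ℕ → L2Plane} (h : IsParsevalDecomposition V ψ)
    {u : L2Plane} {S : Set (ℝ × ℝ)} (hS : MeasurableSet S)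
    (hu : ∀ᵐ z : ℝ × ℝ, z ∉ S → u z = 0) :
    ‖V.starProjection u‖ₑ ^ 2 ≤ ‖u‖ₑ ^ 2 * ∫⁻ z in S, periodization ψ z := by
  rw [h.enorm_sq (V.starProjection_apply_mem u), lintegral_periodization, ← ENNReal.tsum_mul_left]
  refine ENNReal.tsum_le_tsum fun n => ?_
  rw [← ENNReal.tsum_mul_left]
  refine ENNReal.tsum_le_tsum fun p => ?_
  have ht : twistedTranslation p.1 p.2 (ψ n) ∈ V :=
    h.principalSpace_le n (twistedTranslation_mem_principalSpace _ _ _)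
  -- The projection is self-adjoint and fixes the translates of `ψ n`, so the Parseval coefficients
  -- of the projection are those of `u` itself.
  rw [Submodule.inner_starProjection_left_eq_right, Submodule.starProjection_eq_self_iff.2 ht]
  refine (enorm_inner_sq_le_of_ae_eq_zero hS hu _).trans (le_of_eq ?_)
  congr 1
  apply lintegral_congr_ae
  filter_upwards [ae_restrict_of_ae (enorm_twistedTranslation_apply p.1 p.2 (ψ n))] with z hz
  rw [hz]

theorem exists_ae_eq_zero_norm_sub_le (f : L2Plane) {ε : ℝ} (hε : 0 < ε) :
    ∃ h : L2Plane, ‖f - h‖ ≤ ε ∧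
      ∃ r : ℝ, ∀ᵐ z : ℝ × ℝ, z ∉ Metric.ball (0 : ℝ × ℝ) r → h z = 0 := by
  obtain ⟨g, hgc, hg, -, hgm⟩ := (Lp.memLp f).exists_hasCompactSupport_eLpNorm_sub_le
    ENNReal.ofNat_ne_top (ε := ENNReal.ofReal ε) (ENNReal.ofReal_pos.2 hε).ne'
  obtain ⟨r, hr⟩ := hgc.isCompact.isBounded.subset_ball (0 : ℝ × ℝ)
  refine ⟨hgm.toLp g, ?_, r, ?_⟩
  · rw [Lp.norm_def]
    refine ENNReal.toReal_le_of_le_ofReal hε.le (le_of_eq_of_le (eLpNorm_congr_ae ?_) hg)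
    filter_upwards [Lp.coeFn_sub f (hgm.toLp g), hgm.coeFn_toLp] with z h1 h2
    rw [h1, Pi.sub_apply, h2, Pi.sub_apply]
  · filter_upwards [hgm.coeFn_toLp] with z hz hzr
    rw [hz]
    exact image_eq_zero_of_notMem_tsupport fun h => hzr (hr h)

/-! ### Triviality of the intersection. -/

theorem eq_zero_of_forall_mem_dilation_image {V : Submodule ℂ L2Plane}
    [V.HasOrthogonalProjection] {ψ : ℕ → L2Plane} (hψ : IsParsevalDecomposition V ψ)
    (hσ : ∫⁻ η, spectralFunction ψ η < ∞) {a : ℕ → ℝ} (ha : ∀ m, 0 < a m)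
    (ha0 : Tendsto a atTop (𝓝 0)) {f : L2Plane}
    (hf : ∀ m, f ∈ dilation (a m) (ha m) '' (V : Set L2Plane)) : f = 0 := by
  by_contra hne
  have hpos : 0 < ‖f‖ / 2 := half_pos (norm_pos_iff.2 hne)
  obtain ⟨h, hfh, r, hr⟩ := exists_ae_eq_zero_norm_sub_le f hpos
  -- The left side does not depend on `m`, whereas the right side tends to `0`.
  have hlow : ∀ m, ENNReal.ofReal (‖f‖ / 2) ^ 2
      ≤ ‖h‖ₑ ^ 2 * ∫⁻ z in Metric.ball (0 : ℝ × ℝ) (r * a m), periodization ψ z := by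
    intro m
    obtain ⟨g, hgV, rfl⟩ := hf m
    set f := dilation (a m) (ha m) g
    have ha' := inv_pos.2 (ha m)
    have norm_dilation : ∀ v : L2Plane, ‖dilation (a m)⁻¹ ha' v‖ = ‖v‖ := fun v =>
      enorm_eq_iff_norm_eq.1 (enorm_dilation _ ha' v)
    have hg : g = dilation (a m)⁻¹ ha' f := (dilation_inv_dilation _ (ha m) g).symm
    set u := dilation (a m)⁻¹ ha' h
    have hgu : ‖g - u‖ ≤ ‖f‖ / 2 := by
      rw [hg, ← dilation_sub, norm_dilation]
      exact hfh
    have hPg : V.starProjection g = g := Submodule.starProjection_eq_self_iff.2 hgV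
    have hle : ‖f‖ / 2 ≤ ‖V.starProjection u‖ := by
      have h1 : ‖g‖ ≤ ‖V.starProjection (g - u)‖ + ‖V.starProjection u‖ := by
        have h2 := norm_add_le (V.starProjection (g - u)) (V.starProjection u)
        rwa [← map_add, sub_add_cancel, hPg] at h2
      have h3 := V.norm_starProjection_apply_le (g - u)
      have h4 : ‖g‖ = ‖f‖ := by
        rw [hg, norm_dilation]
      linarith
    have hu := dilation_ae_eq_zero_of_ae_eq_zero ha' hr
    -- Dilating by `(a m)⁻¹` shrinks the ball of radius `r` outside which `h` vanishes to radius `r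
    -- * a m`.
    rw [div_inv_eq_mul] at hu
    have h5 := hψ.enorm_starProjection_sq_le Metric.isOpen_ball.measurableSet hu
    rw [enorm_dilation] at h5
    refine le_trans ?_ h5
    gcongr
    rw [← ofReal_norm]
    exact ENNReal.ofReal_le_ofReal hle
  have hlim := ENNReal.Tendsto.const_mul (a := ‖h‖ₑ ^ 2) (tendsto_setLIntegral_ball_periodization hσ
    (r := fun m => r * a m) (by simpa using ha0.const_mul r))
    (Or.inr (ENNReal.pow_ne_top enorm_ne_top))
  rw [mul_zero] at hlim
  have h0 := ge_of_tendsto' hlim hlow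
  exact (ENNReal.pow_pos (ENNReal.ofReal_pos.2 hpos) 2).ne' (nonpos_iff_eq_zero.1 h0)

end TwistedShift

theorem mainTheorem2 (V : Submodule ℂ TwistedShift.L2Plane)
    (hV : TwistedShift.IsTwistedShiftInvariant V)
    (ψ : ℕ → TwistedShift.L2Plane)
    (hψ : TwistedShift.IsParsevalDecomposition V ψ)
    (hσ : ∫⁻ η : ℝ, TwistedShift.spectralFunction ψ η < ∞) :
    ⋂ j : ℤ, TwistedShift.dilation ((2 : ℝ) ^ j) (zpow_pos two_pos j) ''
      (V : Set TwistedShift.L2Plane) = {0} := by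
  have : CompleteSpace V := hV.isClosed.completeSpace_coe
  refine Set.Subset.antisymm (fun f hf => ?_) ?_
  · rw [Set.mem_iInter] at hf
    -- The indices `j = -m ≤ 0` alone already force the intersection to be trivial.
    have ha : Tendsto (fun m : ℕ => (2 : ℝ) ^ (-(m : ℤ))) atTop (𝓝 0) := by
      simpa [← inv_pow] using
        tendsto_pow_atTop_nhds_zero_of_lt_one (r := (2 : ℝ)⁻¹) (by norm_num) (by norm_num)
    exact TwistedShift.eq_zero_of_forall_mem_dilation_image hψ hσ
      (fun m => zpow_pos two_pos _) ha fun m => hf (-(m : ℤ))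
  · rw [Set.singleton_subset_iff, Set.mem_iInter]
    exact fun j => ⟨0, V.zero_mem, TwistedShift.dilation_zero _ _⟩
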